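/- Let $-1<q\le 1$ and put $[n]_q=1+q+\dots+q^{n-1}$, $[n]_q!=\prod_{j=1}^n[j]_q$ (with $[0]_q!=1$), $(c)_\infty=\prod_{k\ge0}(1-cq^k)$, and let $S(q)=\left[-\frac{2}{\sqrt{1-q}},\frac{2}{\sqrt{1-q}}\right]$ if $|q|<1$ and $S(1)=\mathbb R$. For real $a$ let $H_n(x|a,q)$ be the big $q$-Hermite polynomials, defined by $H_{-1}=0$, $H_0=1$ and $$H_{n+1}(x|a,q)=(x-aq^n)H_n(x|a,q)-[n]_qH_{n-1}(x|a,q),\qquad n\ge 0.$$ For $k\ge 0$ put $$V_k(x,a|q)=1-(1-q)axq^k+(1-q)a^2q^{2k},$$ $$W_k(x,y,t|q)=(1-t^2q^{2k})^2-(1-q)xytq^k(1+t^2q^{2k})+(1-q)t^2q^{2k}(x^2+y^2).$$ Let $a,b$ be real with $|a|>|b|$ and let $x,y\in S(q)$. Then the series below converges absolutely and $$0\le\sum_{n\ge0}\frac{b^n}{[n]_q!\,a^n}H_n(x|a,q)H_n(y|b,q).$$ If moreover $|q|<1$, then all $W_k(x,y,\tfrac ba|q)$ are nonzero, the infinite products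 below converge, in the sense that the finite partial products over any enumeration of the factors have the same limit (which may be $0$), and $$\sum_{n\ge0}\frac{b^n}{[n]_q!\,a^n}H_n(x|a,q)H_n(y|b,q)=\left(\frac{b^2}{a^2}\right)_\infty\prod_{k=0}^\infty\frac{V_k(y,b|q)}{W_k(x,y,\frac ba|q)}.$$ -/

import Mathlib

noncomputable section

namespace BigQHermite

/-- The `q`-number `[n]_q = 1 + q + ⋯ + q^(n-1)`. -/
def qNum (q : ℝ) (n : ℕ) : ℝ := ∑ i ∈ Finset.range n, q ^ i

/-- The `q`-factorial `[n]_q! = [1]_q [2]_q ⋯ [n]_q`, with `[0]_q! = 1`. -/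
def qFact (q : ℝ) (n : ℕ) : ℝ := ∏ j ∈ Finset.range n, qNum q (j + 1)

/-- The infinite `q`-Pochhammer symbol `(c; q)_∞ = ∏_{k ≥ 0} (1 - c q^k)`. -/
def qPochInf (c q : ℝ) : ℝ := ∏' k : ℕ, (1 - c * q ^ k)

/-- The support set `S(q)`: the interval `[-2/√(1-q), 2/√(1-q)]` for `|q| < 1`,
and the whole line for `q = 1`. -/
def S (q : ℝ) : Set ℝ :=
  if q = 1 then Set.univ else Set.Icc (-(2 / √(1 - q))) (2 / √(1 - q))

/-- The big `q`-Hermite polynomial `H_n(x | a, q)`, as a function of `x`, by its three-term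
recurrence `H_{n+1} = (x - a q^n) H_n - [n]_q H_{n-1}`, with `H_{-1} = 0` and `H_0 = 1`
(so `H_1 = x - a`). -/
def H (x a q : ℝ) : ℕ → ℝ
  | 0 => 1
  | 1 => x - a
  | n + 2 => (x - a * q ^ (n + 1)) * H x a q (n + 1) - qNum q (n + 1) * H x a q n

/-- `V_k(x, a | q) = 1 - (1-q) a x q^k + (1-q) a² q^(2k)`. -/
def V (k : ℕ) (x a q : ℝ) : ℝ :=
  1 - (1 - q) * a * x * q ^ k + (1 - q) * a ^ 2 * q ^ (2 * k)

/-- `W_k(x, y, t | q) = (1 - t² q^(2k))² - (1-q) x y t q^k (1 + t² q^(2k))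
  + (1-q) t² q^(2k) (x² + y²)`. -/
def W (k : ℕ) (x y t q : ℝ) : ℝ :=
  (1 - t ^ 2 * q ^ (2 * k)) ^ 2 - (1 - q) * x * y * t * q ^ k * (1 + t ^ 2 * q ^ (2 * k))
    + (1 - q) * t ^ 2 * q ^ (2 * k) * (x ^ 2 + y ^ 2)

end BigQHermite

end

namespace BigQHermite

open Finset Filter Topology

/-! Write b = ρa with |ρ| < 1, and regard the series as a function K(ρ, a), the `kernel`. For |q| <
1 it satisfies two functional equations. Lowering a to qa in both polynomials gives K(ρ, a) = V_0(y,
ρa) K(ρ, qa) (`kernel_eq_V_mul_kernel`). At a = 0, the three-term recurrences give W_0 K(ρ, 0) = (1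
- ρ²)(1 - qρ²) K(qρ, 0) (`kernel_zero_mul_W`). Iterating the first reduces to a = 0, and iterating
the second reduces to K(0, 0) = 1. This yields the product formula, whose factors are all
nonnegative.

The analytic input is that H_n² / [n]_q! grows more slowly than r^n for every r > 1. This gives
absolute convergence and justifies the limits. For fixed |q| < 1 it comes from comparison with the
Chebyshev recurrence on [-2, 2] (`exists_H_sq_le`). For q = 1 there is no product, and nonnegativity
is obtained by letting q → 1 from below. That limit needs a growth bound uniform in q near 1, proved
separately in `exists_eventually_H_sq_le`. -/

/-! ### Algebra and continuity of q-numbers and big q-Hermite polynomials. -/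

theorem one_sub_mul_qNum (q : ℝ) (n : ℕ) : (1 - q) * qNum q n = 1 - q ^ n :=
  mul_neg_geom_sum q n

theorem qNum_succ (q : ℝ) (n : ℕ) : qNum q (n + 1) = qNum q n + q ^ n :=
  Finset.sum_range_succ _ _

theorem qNum_succ' (q : ℝ) (n : ℕ) : qNum q (n + 1) = 1 + q * qNum q n := by
  have h : ∑ i ∈ range n, q ^ (i + 1) = q * ∑ i ∈ range n, q ^ i := by
    rw [Finset.mul_sum]; exact Finset.sum_congr rfl fun i _ => by ring
  simp only [qNum, Finset.sum_range_succ', h]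
  ring

theorem qNum_mono {q : ℝ} (hq : 0 ≤ q) : Monotone (qNum q) :=
  monotone_nat_of_le_succ fun n => by
    rw [qNum_succ]; exact le_add_of_nonneg_right (pow_nonneg hq _)

theorem abs_pow_lt_one {q : ℝ} (hq : |q| < 1) (n : ℕ) : |q ^ (n + 1)| < 1 := by
  rw [abs_pow]; exact pow_lt_one₀ (abs_nonneg _) hq (Nat.succ_ne_zero _)

theorem qNum_succ_pos {q : ℝ} (hq : -1 < q) (hq1 : q ≤ 1) (n : ℕ) : 0 < qNum q (n + 1) := by
  rcases hq1.lt_or_eq with h | rfl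
  · have h1 := one_sub_mul_qNum q (n + 1)
    have h2 := (abs_lt.1 (abs_pow_lt_one (abs_lt.2 ⟨hq, h⟩) n)).2
    have h3 : 0 < (1 - q) * qNum q (n + 1) := by linarith
    exact (mul_pos_iff_of_pos_left (by linarith)).1 h3
  · simp only [qNum, one_pow, sum_const, card_range, nsmul_eq_mul, mul_one]
    positivity

theorem qFact_succ (q : ℝ) (n : ℕ) : qFact q (n + 1) = qFact q n * qNum q (n + 1) :=
  Finset.prod_range_succ _ _

theorem qFact_pos {q : ℝ} (hq : -1 < q) (hq1 : q ≤ 1) (n : ℕ) : 0 < qFact q n :=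
  Finset.prod_pos fun _ _ => qNum_succ_pos hq hq1 _

theorem H_succ_succ (x a q : ℝ) (n : ℕ) :
    H x a q (n + 2) = (x - a * q ^ (n + 1)) * H x a q (n + 1) - qNum q (n + 1) * H x a q n :=
  rfl

/-- The recurrence of `H` at every index, where the coefficient `[0]_q = 0` makes the value
at the truncated index `0 - 1` irrelevant. -/
theorem H_succ (x a q : ℝ) (n : ℕ) :
    H x a q (n + 1) = (x - a * q ^ n) * H x a q n - qNum q n * H x a q (n - 1) := by
  cases n with
  | zero => simp [H, qNum]
  | succ n => exact H_succ_succ x a q n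

/-- Changing the parameter `a` to `q a`. -/
theorem H_eq_H_mul (x a q : ℝ) (n : ℕ) :
    H x a q n = H x (q * a) q n - (1 - q ^ n) * a * H x (q * a) q (n - 1) := by
  suffices h : ∀ n, H x a q n = H x (q * a) q n - (1 - q ^ n) * a * H x (q * a) q (n - 1) ∧
      H x a q (n + 1) = H x (q * a) q (n + 1) - (1 - q ^ (n + 1)) * a * H x (q * a) q n from
    (h n).1
  intro n
  induction n with
  | zero => constructor <;> simp [H]; ring
  | succ n ih =>
    refine ⟨ih.2, ?_⟩
    have e1 := H_succ x (q * a) q n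
    rw [H_succ_succ, H_succ_succ, ih.1, ih.2]
    have e2 := one_sub_mul_qNum q n
    have e3 := one_sub_mul_qNum q (n + 1)
    have e4 : (1 - q ^ n) * qNum q (n + 1) = (1 - q ^ (n + 1)) * qNum q n := by
      rw [← e2, ← e3]; ring
    linear_combination ((1 - q ^ (n + 1)) * a) * e1 + (a * H x (q * a) q (n - 1)) * e4

theorem continuous_qNum (n : ℕ) : Continuous fun q => qNum q n := by
  unfold qNum; fun_prop

theorem continuous_qFact (n : ℕ) : Continuous fun q => qFact q n :=
  continuous_finsetProd _ fun _ _ => continuous_qNum _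

/-- Serves both termwise limits: parameter tending to 0 at fixed q, and q tending to 1 at fixed
parameter. -/
theorem continuous_H (x : ℝ) (n : ℕ) : Continuous fun p : ℝ × ℝ => H x p.1 p.2 n := by
  suffices h : ∀ n, (Continuous fun p : ℝ × ℝ => H x p.1 p.2 n) ∧
      Continuous fun p : ℝ × ℝ => H x p.1 p.2 (n + 1) from (h n).1
  intro n
  induction n with
  | zero => exact ⟨continuous_const, by simp only [H]; fun_prop⟩
  | succ n ih =>
    refine ⟨ih.2, ?_⟩
    simp only [H_succ_succ]
    have h1 := ih.1
    have h2 := ih.2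
    have h3 : Continuous fun p : ℝ × ℝ => qNum p.2 (n + 1) :=
      (continuous_qNum (n + 1)).comp continuous_snd
    fun_prop

/-! ### Growth of the polynomials for fixed |q| < 1. -/

theorem prod_one_add_mul_pow_le_exp {C p : ℝ} (hC : 0 ≤ C) (hp : 0 ≤ p) (hp1 : p < 1) (n : ℕ) :
    ∏ k ∈ range n, (1 + C * p ^ k) ≤ Real.exp (C * (1 - p)⁻¹) := by
  calc ∏ k ∈ range n, (1 + C * p ^ k) ≤ ∏ k ∈ range n, Real.exp (C * p ^ k) :=
        Finset.prod_le_prod (fun _ _ => by positivity)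
          fun k _ => by rw [add_comm]; exact Real.add_one_le_exp _
    _ = Real.exp (C * ∑ k ∈ range n, p ^ k) := by rw [← Real.exp_sum, Finset.mul_sum]
    _ ≤ _ := by
      have := (summable_geometric_of_lt_one hp hp1).sum_le_tsum (range n)
        (fun _ _ => pow_nonneg hp _)
      rw [tsum_geometric_of_lt_one hp hp1] at this
      exact Real.exp_le_exp.2 (mul_le_mul_of_nonneg_left this hC)

/-- Subexponential growth of solutions of a perturbed Chebyshev recurrence with argument in
the closed interval `[-2, 2]`. -/
theorem abs_le_of_perturbed_chebyshev {u : ℕ → ℝ} {ξ α q ε A : ℝ} (hξ : ξ ^ 2 ≤ 4)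
    (hq : |q| < 1) (hε : 0 < ε) (hε1 : ε ≤ 1) (hα : 1 + |α| ≤ A) (h0 : u 0 = 1)
    (h1 : u 1 = ξ - α)
    (hu : ∀ n, u (n + 2) = (ξ - α * q ^ (n + 1)) * u (n + 1) - (1 - q ^ (n + 1)) * u n) (n : ℕ) :
    |u n| ≤ (3 + A) / ε * Real.exp (A / ε * (1 - |q|)⁻¹) * (1 + ε) ^ n := by
  have hA : 1 ≤ A := le_trans (by simp) hα
  -- Since |ξ| ≤ 2, the roots of z² - ξz + 1 are conjugate on the unit circle. Factoring the
  -- unperturbed recurrence through z leaves v with a first-order recurrence of multiplier of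
  -- modulus 1 and a geometrically small error.
  obtain ⟨z, hz, hz1⟩ : ∃ z : ℂ, z + (starRingEnd ℂ) z = ξ ∧ z * (starRingEnd ℂ) z = 1 := by
    have hs : √(1 - ξ ^ 2 / 4) * √(1 - ξ ^ 2 / 4) = 1 - ξ ^ 2 / 4 :=
      Real.mul_self_sqrt (by linarith)
    refine ⟨⟨ξ / 2, √(1 - ξ ^ 2 / 4)⟩, ?_, ?_⟩ <;> apply Complex.ext <;> simp
    · rw [hs]; ring
    · ring
  have hzn : ‖z‖ = 1 := by
    have := congrArg norm hz1
    rw [norm_mul, RCLike.norm_conj, norm_one] at this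
    nlinarith [norm_nonneg z]
  set v : ℕ → ℂ := fun n => (u (n + 1) : ℂ) - z * u n with hv
  have hv1 : ∀ n, v (n + 1) = (starRingEnd ℂ) z * v n +
      (q : ℂ) ^ (n + 1) * (u n - α * u (n + 1)) := by
    intro n
    simp only [hv, hu]
    push_cast
    linear_combination (-(u (n + 1) : ℂ)) * hz + (u n : ℂ) * hz1
  have hun : ∀ n, |u (n + 1)| ≤ |u n| + ‖v n‖ := by
    intro n
    have : (u (n + 1) : ℂ) = z * u n + v n := by simp [hv]
    calc |u (n + 1)| = ‖(u (n + 1) : ℂ)‖ := by simp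
      _ ≤ ‖z * u n‖ + ‖v n‖ := by rw [this]; exact norm_add_le _ _
      _ = _ := by simp [hzn]
  have hvn : ∀ n, ‖v (n + 1)‖ ≤ ‖v n‖ + |q| ^ n * (|u n| + |α| * |u (n + 1)|) := by
    intro n
    rw [hv1]
    refine (norm_add_le _ _).trans ?_
    rw [norm_mul, RCLike.norm_conj, hzn, one_mul, norm_mul, norm_pow]
    have e1 : ‖(u n : ℂ) - α * u (n + 1)‖ ≤ |u n| + |α| * |u (n + 1)| := by
      refine (norm_sub_le _ _).trans ?_
      simp
    have e2 : ‖(q : ℂ)‖ ^ (n + 1) ≤ |q| ^ n := by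
      rw [Complex.norm_real, Real.norm_eq_abs]
      exact pow_le_pow_of_le_one (abs_nonneg _) hq.le (Nat.le_succ _)
    gcongr
  -- Weighting |u| by ε makes the coupling |u (n+1)| ≤ |u n| + ‖v n‖ cost only a factor 1 + ε per
  -- step, even at the double root ξ = ±2. The perturbation contributes a convergent product. The
  -- constant 3 + A bounds the initial value, at most 4 + |α|.
  have key : ∀ n, ε * |u n| + ‖v n‖ ≤
      (3 + A) * ∏ k ∈ range n, ((1 + ε) * (1 + A / ε * |q| ^ k)) := by
    intro n
    induction n with
    | zero =>
      have hξ2 : |ξ| ≤ 2 := abs_le_of_sq_le_sq (by linarith) (by norm_num)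
      have : ‖v 0‖ ≤ |ξ - α| + 1 := by
        simp only [hv, h0, h1, zero_add]
        refine (norm_sub_le _ _).trans ?_
        rw [Complex.norm_real]
        simp [hzn]
      have := abs_sub ξ α
      simp only [h0, abs_one, mul_one, range_zero, prod_empty]
      linarith
    | succ n ih =>
      rw [Finset.prod_range_succ, ← mul_assoc]
      refine le_trans ?_ (mul_le_mul_of_nonneg_right ih (by positivity))
      have i1 := hun n
      have i2 := hvn n
      set U := |u n|
      set N := ‖v n‖
      have hU : 0 ≤ U := abs_nonneg _
      have hN : 0 ≤ N := norm_nonneg _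
      set Q := |q| ^ n
      have hQ : 0 ≤ Q := by positivity
      have i3 : U + |α| * |u (n + 1)| ≤ A * (U + N) := by
        nlinarith [abs_nonneg α, mul_le_mul_of_nonneg_left i1 (abs_nonneg α)]
      have i4 : Q * (U + |α| * |u (n + 1)|) ≤ Q * (A * (U + N)) := by gcongr
      have i5 : U + N ≤ 1 / ε * (ε * U + N) := by
        rw [mul_add, ← mul_assoc, one_div_mul_cancel hε.ne', one_mul]
        have : 1 ≤ 1 / ε := by rw [le_div_iff₀ hε]; linarith
        nlinarith
      have i6 : Q * (A * (U + N)) ≤ A / ε * Q * (ε * U + N) := by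
        calc Q * (A * (U + N)) ≤ Q * (A * (1 / ε * (ε * U + N))) := by gcongr
          _ = _ := by ring
      have i7 : 0 ≤ ε * (A / ε * Q * (ε * U + N)) := by positivity
      have i8 : ε * |u (n + 1)| ≤ ε * (U + N) := by gcongr
      nlinarith [mul_nonneg hε.le (mul_nonneg hε.le hU)]
  have h2 := prod_one_add_mul_pow_le_exp (C := A / ε) (by positivity) (abs_nonneg q) hq n
  have h3 := key n
  rw [Finset.prod_mul_distrib, Finset.prod_const, card_range] at h3
  have h4 : ε * |u n| ≤ (3 + A) * ((1 + ε) ^ n * Real.exp (A / ε * (1 - |q|)⁻¹)) := by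
    calc ε * |u n| ≤ ε * |u n| + ‖v n‖ := le_add_of_nonneg_right (norm_nonneg _)
      _ ≤ _ := h3
      _ ≤ _ := by gcongr
  rw [← le_div_iff₀' hε] at h4
  calc _ ≤ _ := h4
    _ = _ := by ring

/-- The `q`-shifted factorial `(q; q)_n` is bounded away from zero. -/
theorem exists_one_le_mul_prod {q : ℝ} (hq : |q| < 1) :
    ∃ K, 0 < K ∧ ∀ n, 1 ≤ K * ∏ j ∈ range n, (1 - q ^ (j + 1)) := by
  -- This constant bounds the products of 1 + |q|^j / (1 - |q|), whose factors dominate 1 / (1 -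
  -- q^(j+1)).
  refine ⟨_, Real.exp_pos (1 / (1 - |q|) * (1 - |q|)⁻¹), fun n => ?_⟩
  have hq' : 0 < 1 - |q| := by linarith
  have hpos : ∀ j, 0 < 1 - q ^ (j + 1) := fun j => by
    linarith [(abs_lt.1 (abs_pow_lt_one hq j)).2]
  have h := prod_one_add_mul_pow_le_exp (C := 1 / (1 - |q|)) (by positivity) (abs_nonneg q) hq n
  refine le_trans ?_ (mul_le_mul_of_nonneg_right h (Finset.prod_nonneg fun j _ => (hpos j).le))
  rw [← Finset.prod_mul_distrib]
  refine Finset.one_le_prod fun j _ => ?_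
  have h1 : q ^ (j + 1) ≤ |q| ^ (j + 1) := by rw [← abs_pow]; exact le_abs_self _
  have h2 : |q| ^ (j + 1) ≤ |q| ^ j := pow_le_pow_of_le_one (abs_nonneg _) hq.le (Nat.le_succ _)
  have h3 : |q| ^ (j + 1) ≤ |q| := pow_le_of_le_one (abs_nonneg _) hq.le (Nat.succ_ne_zero _)
  have h4 : 0 ≤ |q| ^ j := by positivity
  rw [one_div_mul_eq_div, one_add_div hq'.ne', div_mul_eq_mul_div, le_div_iff₀ hq', one_mul]
  nlinarith

theorem exists_small_sq_le {r : ℝ} (hr : 1 < r) : ∃ ε, 0 < ε ∧ ε ≤ 1 ∧ (1 + ε) ^ 2 ≤ r := by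
  refine ⟨min 1 ((r - 1) / 3), lt_min one_pos (by linarith), min_le_left _ _, ?_⟩
  have h1 := min_le_left 1 ((r - 1) / 3)
  have h2 := min_le_right 1 ((r - 1) / 3)
  have h3 : 0 ≤ min 1 ((r - 1) / 3) := le_min zero_le_one (by linarith)
  nlinarith

/-- For `|q| < 1` and `x ∈ S(q)`, the normalized big `q`-Hermite polynomials grow
subexponentially, uniformly for bounded parameter. -/
theorem exists_H_sq_le {q x : ℝ} (hq : |q| < 1) (hx : (1 - q) * x ^ 2 ≤ 4) (A : ℝ)
    {r : ℝ} (hr : 1 < r) :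
    ∃ K, ∀ c, |c| ≤ A → ∀ n, H x c q n ^ 2 ≤ K * r ^ n * qFact q n := by
  obtain ⟨ε, hε, hε1, hεr⟩ := exists_small_sq_le hr
  obtain ⟨K, hK, hKn⟩ := exists_one_le_mul_prod hq
  have hq2 := abs_lt.1 hq
  set s := √(1 - q) with hs
  have hs2 : s ^ 2 = 1 - q := Real.sq_sqrt (by linarith)
  have hs0 : 0 < s := Real.sqrt_pos.2 (by linarith)
  set M := (3 + (1 + s * A)) / ε * Real.exp ((1 + s * A) / ε * (1 - |q|)⁻¹)
  refine ⟨M ^ 2 * K, fun c hc n => ?_⟩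
  -- Scaling by s = √(1 - q) turns [n]_q into 1 - q^n and moves x to sx in [-2, 2].
  have hu : |s ^ n * H x c q n| ≤ M * (1 + ε) ^ n := by
    refine abs_le_of_perturbed_chebyshev (u := fun n => s ^ n * H x c q n) (ξ := s * x)
      (α := s * c) ?_ hq hε hε1 ?_ ?_ ?_ ?_ n
    · rw [mul_pow, hs2]; exact hx
    · rw [abs_mul, abs_of_pos hs0]; gcongr
    · simp [H]
    · simp [H]; ring
    · intro n
      have := one_sub_mul_qNum q (n + 1)
      rw [← hs2] at this
      simp only [H_succ_succ]
      linear_combination (-s ^ n * H x c q n) * this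
  have hfact : s ^ (2 * n) * qFact q n = ∏ j ∈ range n, (1 - q ^ (j + 1)) := by
    rw [pow_mul, hs2, qFact]
    simp only [← one_sub_mul_qNum, Finset.prod_mul_distrib, Finset.prod_const, card_range]
  have hp := hKn n
  rw [← hfact] at hp
  have hu2 : (s ^ n * H x c q n) ^ 2 ≤ M ^ 2 * r ^ n := by
    calc (s ^ n * H x c q n) ^ 2 = |s ^ n * H x c q n| ^ 2 := (sq_abs _).symm
      _ ≤ (M * (1 + ε) ^ n) ^ 2 := by gcongr
      _ = M ^ 2 * ((1 + ε) ^ 2) ^ n := by rw [mul_pow, pow_right_comm]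
      _ ≤ M ^ 2 * r ^ n := by gcongr
  have hf := qFact_pos hq2.1 hq2.2.le n
  have hs2n : 0 < s ^ (2 * n) := by positivity
  have hr0 : 0 ≤ r ^ n := by positivity
  have : s ^ (2 * n) * H x c q n ^ 2 ≤ s ^ (2 * n) * (M ^ 2 * K * r ^ n * qFact q n) := by
    calc s ^ (2 * n) * H x c q n ^ 2 = (s ^ n * H x c q n) ^ 2 := by ring
      _ ≤ M ^ 2 * r ^ n := hu2
      _ ≤ (M ^ 2 * r ^ n) * (K * (s ^ (2 * n) * qFact q n)) :=
        le_mul_of_one_le_right (by positivity) hp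
      _ = _ := by ring
  exact le_of_mul_le_mul_left this hs2n

/-! ### Growth of the polynomials uniformly near q = 1. -/

/-- After division by √[n]_q!, the recurrence increases a monotone majorant by at most 1 + A /
√[n+1]_q, because [n]_q is nondecreasing in n for q ≥ 0. No factor 1 / (1 - q) enters, so the bound
survives q → 1. -/
theorem abs_H_le {q x a A : ℝ} (hq : 0 ≤ q) (hq1 : q ≤ 1) (hxa : |x| + |a| ≤ A)
    {D : ℕ → ℝ} (h0 : 1 ≤ D 0) (hmono : Monotone D)
    (hD : ∀ n, D n * (1 + A / √(qNum q (n + 1))) ≤ D (n + 1)) (n : ℕ) :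
    |H x a q n| ≤ D n * √(qFact q n) := by
  have hD0 : ∀ n, 0 ≤ D n := fun n => by linarith [hmono (Nat.zero_le n)]
  suffices h : ∀ n, |H x a q n| ≤ D n * √(qFact q n) ∧
      |H x a q (n + 1)| ≤ D (n + 1) * √(qFact q (n + 1)) from (h n).1
  have hxq : ∀ n, |x - a * q ^ n| ≤ A := fun n => by
    refine (abs_sub _ _).trans (le_trans ?_ hxa)
    rw [abs_mul, abs_pow, abs_of_nonneg hq]
    have := mul_le_of_le_one_right (abs_nonneg a) (pow_le_one₀ hq hq1 (n := n))
    linarith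
  have hA : 0 ≤ A := (abs_nonneg _).trans (hxq 0)
  intro n
  induction n with
  | zero =>
    have h1 := hD 0
    have h2 := hxq 0
    have e : qNum q 1 = 1 := by simp [qNum]
    simp only [zero_add, e, Real.sqrt_one, div_one] at h1
    simp only [pow_zero, mul_one] at h2
    refine ⟨by simpa [H, qFact] using h0, ?_⟩
    simp only [zero_add, H, qFact, prod_range_one, e, Real.sqrt_one, mul_one]
    nlinarith
  | succ n ih =>
    refine ⟨ih.2, ?_⟩
    have hp := qNum_succ_pos (by linarith) hq1 n
    have hp2 := qNum_succ_pos (by linarith) hq1 (n + 1)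
    have hs : 0 < √(qNum q (n + 2)) := Real.sqrt_pos.2 hp2
    have e1 : √(qFact q (n + 1)) = √(qFact q n) * √(qNum q (n + 1)) := by
      rw [qFact_succ, Real.sqrt_mul (qFact_pos (by linarith) hq1 n).le]
    have e2 : √(qFact q (n + 2)) = √(qFact q (n + 1)) * √(qNum q (n + 2)) := by
      rw [qFact_succ, Real.sqrt_mul (qFact_pos (by linarith) hq1 (n + 1)).le]
    have e3 : √(qNum q (n + 1)) * √(qNum q (n + 1)) = qNum q (n + 1) := Real.mul_self_sqrt hp.le
    have e4 : √(qNum q (n + 1)) ≤ √(qNum q (n + 2)) :=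
      Real.sqrt_le_sqrt (qNum_mono hq (Nat.le_succ _))
    have hDn : D n ≤ D (n + 1) := hmono (Nat.le_succ _)
    have hDp := hD0 (n + 1)
    rw [H_succ_succ]
    calc |(x - a * q ^ (n + 1)) * H x a q (n + 1) - qNum q (n + 1) * H x a q n|
        ≤ |x - a * q ^ (n + 1)| * |H x a q (n + 1)| + qNum q (n + 1) * |H x a q n| := by
          refine (abs_sub _ _).trans ?_
          rw [abs_mul, abs_mul, abs_of_pos hp]
      _ ≤ A * (D (n + 1) * √(qFact q (n + 1))) + qNum q (n + 1) * (D (n + 1) * √(qFact q n)) := by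
          refine add_le_add (mul_le_mul (hxq _) ih.2 (abs_nonneg _) hA)
            (mul_le_mul_of_nonneg_left (ih.1.trans ?_) hp.le)
          gcongr
      _ = D (n + 1) * √(qFact q (n + 1)) * (A + √(qNum q (n + 1))) := by
          rw [e1]; linear_combination (-D (n + 1) * √(qFact q n)) * e3
      _ ≤ D (n + 1) * √(qFact q (n + 1)) * (A + √(qNum q (n + 2))) := by gcongr
      _ = D (n + 1) * (1 + A / √(qNum q (n + 2))) * √(qFact q (n + 2)) := by
          rw [e2]; field_simp; ring
      _ ≤ _ := mul_le_mul_of_nonneg_right (hD (n + 1)) (Real.sqrt_nonneg _)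

/-- Subexponential growth of the normalized polynomials, uniformly as `q → 1`. -/
theorem exists_eventually_H_sq_le (A : ℝ) {r : ℝ} (hr : 1 < r) :
    ∃ K, ∀ᶠ q in 𝓝[≤] (1 : ℝ), 0 ≤ q ∧ ∀ x a, |x| + |a| ≤ A →
      ∀ n, H x a q n ^ 2 ≤ K * r ^ n * qFact q n := by
  wlog hA : 0 ≤ A generalizing A
  · obtain ⟨K, hK⟩ := this 0 le_rfl
    exact ⟨K, hK.mono fun q h => ⟨h.1, fun x a hxa => h.2 x a (by linarith)⟩⟩
  obtain ⟨ε, hε, hε1, hεr⟩ := exists_small_sq_le hr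
  -- As [N]_q → N, for q near 1 every n ≥ N has A / √[n+1]_q ≤ ε. So the majorant need only absorb a
  -- factor 1 + A during the first N steps and 1 + ε at each step.
  obtain ⟨N, hN⟩ := exists_nat_gt ((A / ε) ^ 2)
  refine ⟨((1 + A) ^ N) ^ 2, ?_⟩
  have hcont : Tendsto (fun q => qNum q N) (𝓝[≤] 1) (𝓝 N) := by
    have := (continuous_qNum N).tendsto 1
    simp only [qNum, one_pow, sum_const, card_range, nsmul_eq_mul, mul_one] at this
    exact this.mono_left nhdsWithin_le_nhds
  filter_upwards [hcont.eventually_const_lt hN, self_mem_nhdsWithin,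
    mem_nhdsWithin_of_mem_nhds (eventually_ge_nhds (zero_lt_one' ℝ))] with q hqN hq1 hq0
  refine ⟨hq0, fun x a hxa n => ?_⟩
  have hq1 : q ≤ 1 := hq1
  have h := abs_H_le hq0 hq1 hxa (D := fun n => (1 + A) ^ min n N * (1 + ε) ^ n)
    (by simp) ?_ ?_ n
  · have hf := (qFact_pos (by linarith) hq1 n).le
    calc H x a q n ^ 2 = |H x a q n| ^ 2 := (sq_abs _).symm
      _ ≤ ((1 + A) ^ min n N * (1 + ε) ^ n * √(qFact q n)) ^ 2 := by gcongr
      _ = ((1 + A) ^ min n N) ^ 2 * ((1 + ε) ^ 2) ^ n * qFact q n := by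
        rw [mul_pow, Real.sq_sqrt hf, mul_pow, pow_right_comm (1 + ε)]
      _ ≤ ((1 + A) ^ N) ^ 2 * r ^ n * qFact q n := by
        gcongr
        · linarith
        · exact min_le_right _ _
  · refine monotone_nat_of_le_succ fun n => ?_
    gcongr
    · linarith
    · omega
    · linarith
    · omega
  · intro n
    by_cases hn : n < N
    · have e1 : min n N = n := min_eq_left hn.le
      have e2 : min (n + 1) N = n + 1 := min_eq_left hn
      simp only [e1, e2]
      have h1 : 1 ≤ √(qNum q (n + 1)) := by
        rw [Real.one_le_sqrt]
        simpa [qNum] using qNum_mono hq0 (Nat.le_add_left 1 n)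
      have h2 : A / √(qNum q (n + 1)) ≤ A := div_le_self hA h1
      calc (1 + A) ^ n * (1 + ε) ^ n * (1 + A / √(qNum q (n + 1)))
          ≤ (1 + A) ^ n * (1 + ε) ^ n * (1 + A) := by gcongr
        _ ≤ (1 + A) ^ n * (1 + ε) ^ n * (1 + A) * (1 + ε) :=
          le_mul_of_one_le_right (by positivity) (by linarith)
        _ = _ := by ring
    · push Not at hn
      have e1 : min n N = N := min_eq_right hn
      have e2 : min (n + 1) N = N := min_eq_right (by omega)
      simp only [e1, e2]
      have h1 : (A / ε) ^ 2 < qNum q (n + 1) := hqN.trans_le (qNum_mono hq0 (by omega))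
      have h2 : A / ε < √(qNum q (n + 1)) := Real.lt_sqrt_of_sq_lt h1
      have h3 : A / √(qNum q (n + 1)) ≤ ε := by
        rw [div_le_iff₀ (lt_of_le_of_lt (by positivity) h2), ← div_le_iff₀' hε]
        exact h2.le
      calc (1 + A) ^ N * (1 + ε) ^ n * (1 + A / √(qNum q (n + 1)))
          ≤ (1 + A) ^ N * (1 + ε) ^ n * (1 + ε) := by gcongr
        _ = _ := by ring

/-! ### Subexponential growth and summability. -/

/-- Sequences whose squares are `O(r^n [n]_q!)` for every `r > 1`. -/
def SubexpGrowth (q : ℝ) (f : ℕ → ℝ) : Prop :=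
  ∀ r, 1 < r → ∃ K, ∀ n, f n ^ 2 ≤ K * r ^ n * qFact q n

theorem abs_qWeight_mul_le {q ρ r K L u v : ℝ} {n : ℕ} (hq : -1 < q) (hq1 : q ≤ 1)
    (hu : u ^ 2 ≤ K * r ^ n * qFact q n) (hv : v ^ 2 ≤ L * r ^ n * qFact q n) :
    |ρ ^ n / qFact q n * (u * v)| ≤ (K + L) * (|ρ| * r) ^ n := by
  have hf := qFact_pos hq hq1 n
  have h : |u * v| ≤ (K + L) * r ^ n * qFact q n := by
    rw [abs_mul]
    nlinarith [sq_nonneg (|u| - |v|), sq_abs u, sq_abs v, abs_nonneg u, abs_nonneg v,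
      sq_nonneg u, sq_nonneg v]
  rw [abs_mul, abs_div, abs_of_pos hf, abs_pow, mul_pow]
  calc |ρ| ^ n / qFact q n * |u * v| ≤ |ρ| ^ n / qFact q n * ((K + L) * r ^ n * qFact q n) := by
        gcongr
    _ = _ := by field_simp

theorem exists_one_lt_mul_lt_one {ρ : ℝ} (hρ : |ρ| < 1) : ∃ r, 1 < r ∧ |ρ| * r < 1 := by
  refine ⟨2 / (1 + |ρ|), ?_, ?_⟩
  · rw [lt_div_iff₀ (by positivity)]; linarith
  · rw [mul_div_assoc', div_lt_one (by positivity)]; linarith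

theorem SubexpGrowth.summable_mul {q ρ : ℝ} {f g : ℕ → ℝ} (hq : -1 < q) (hq1 : q ≤ 1)
    (hρ : |ρ| < 1) (hf : SubexpGrowth q f) (hg : SubexpGrowth q g) :
    Summable fun n => ρ ^ n / qFact q n * (f n * g n) := by
  obtain ⟨r, hr, hr1⟩ := exists_one_lt_mul_lt_one hρ
  obtain ⟨K, hK⟩ := hf r hr
  obtain ⟨L, hL⟩ := hg r hr
  refine Summable.of_norm_bounded
    ((summable_geometric_of_lt_one (by positivity) hr1).mul_left (K + L)) fun n => ?_
  exact abs_qWeight_mul_le hq hq1 (hK n) (hL n)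

/-- For |q| < 1 the ratio [n+1]_q of consecutive q-factorials is bounded by 2 / (1 - q). -/
theorem SubexpGrowth.succ {q : ℝ} {f : ℕ → ℝ} (hq : |q| < 1) (hf : SubexpGrowth q f) :
    SubexpGrowth q fun n => f (n + 1) := by
  intro r hr
  obtain ⟨K, hK⟩ := hf r hr
  have hq' := abs_lt.1 hq
  refine ⟨|K| * r * (2 / (1 - q)), fun n => (hK (n + 1)).trans ?_⟩
  have h1 : qNum q (n + 1) ≤ 2 / (1 - q) := by
    rw [le_div_iff₀ (by linarith), mul_comm, one_sub_mul_qNum]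
    linarith [(abs_lt.1 (abs_pow_lt_one hq n)).1]
  have h2 := qFact_pos hq'.1 hq'.2.le n
  have h3 := qNum_succ_pos hq'.1 hq'.2.le n
  rw [qFact_succ, pow_succ]
  calc K * (r ^ n * r) * (qFact q n * qNum q (n + 1))
      ≤ |K| * (r ^ n * r) * (qFact q n * (2 / (1 - q))) := by
        gcongr
        exact le_abs_self K
    _ = _ := by ring

theorem SubexpGrowth.mul_le_one {q : ℝ} {f e : ℕ → ℝ}
    (he : ∀ n, |e n| ≤ 1) (hf : SubexpGrowth q f) : SubexpGrowth q fun n => e n * f n := by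
  intro r hr
  obtain ⟨K, hK⟩ := hf r hr
  refine ⟨K, fun n => le_trans ?_ (hK n)⟩
  rw [mul_pow]
  exact mul_le_of_le_one_left (sq_nonneg _) ((sq_le_one_iff_abs_le_one _).2 (he n))

theorem subexpGrowth_H {q x : ℝ} (hq : |q| < 1) (hx : (1 - q) * x ^ 2 ≤ 4) (a : ℝ) :
    SubexpGrowth q (H x a q) := fun _ hr =>
  let ⟨K, hK⟩ := exists_H_sq_le hq hx |a| hr
  ⟨K, hK a le_rfl⟩

/-- Shift of the summation index in a `q`-exponential series. -/
theorem hasSum_qNum_mul {q ρ s : ℝ} {f : ℕ → ℝ} (hq : -1 < q) (hq1 : q ≤ 1)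
    (h : HasSum (fun n => ρ ^ n / qFact q n * f (n + 1)) s) :
    HasSum (fun n => ρ ^ n / qFact q n * (qNum q n * f n)) (ρ * s) := by
  -- The term n = 0 vanishes because [0]_q = 0, so f 0 is irrelevant; in the applications it may
  -- involve the truncated index 0 - 1.
  rw [← hasSum_nat_add_iff' 1]
  have h0 : qNum q 0 = 0 := by simp [qNum]
  simp only [sum_range_one, h0, zero_mul, mul_zero, sub_zero]
  refine (h.mul_left ρ).congr_fun fun n => ?_
  have h1 := (qFact_pos hq hq1 n).ne'
  have h2 := (qNum_succ_pos hq hq1 n).ne'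
  rw [qFact_succ]
  field_simp
  ring

/-! ### The kernel, its two functional equations and its continuity. -/

/-- The kernel `∑ ρ^n / [n]_q! H_n(x | a, q) H_n(y | ρ a, q)`. -/
noncomputable def kernel (x y q ρ a : ℝ) : ℝ :=
  ∑' n, ρ ^ n / qFact q n * (H x a q n * H y (ρ * a) q n)

theorem summable_kernel {x y q ρ : ℝ} (hq : |q| < 1) (hρ : |ρ| < 1) (hx : (1 - q) * x ^ 2 ≤ 4)
    (hy : (1 - q) * y ^ 2 ≤ 4) (a : ℝ) :
    Summable fun n => ρ ^ n / qFact q n * (H x a q n * H y (ρ * a) q n) :=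
  (subexpGrowth_H hq hx a).summable_mul (abs_lt.1 hq).1 (abs_lt.1 hq).2.le hρ
    (subexpGrowth_H hq hy (ρ * a))

/-- Expand both polynomials by `H_eq_H_mul`; the factors 1 - q^n = (1 - q)[n]_q shift the summation
index. The recurrence in y rewrites one cross term, after which the sums S1 and S2 cancel exactly
because the second parameter is ρ times the first. -/
theorem kernel_eq_V_mul_kernel {x y q ρ : ℝ} (hq : |q| < 1) (hρ : |ρ| < 1)
    (hx : (1 - q) * x ^ 2 ≤ 4) (hy : (1 - q) * y ^ 2 ≤ 4) (a : ℝ) :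
    kernel x y q ρ a = V 0 y (ρ * a) q * kernel x y q ρ (q * a) := by
  have hq1 := (abs_lt.1 hq).1
  have hq2 := (abs_lt.1 hq).2.le
  have hh := subexpGrowth_H hq hx (q * a)
  have hk := subexpGrowth_H hq hy (ρ * (q * a))
  set h := H x (q * a) q with h_def
  set k := H y (ρ * (q * a)) q with k_def
  have hqn : ∀ n, |q ^ (n + 1)| ≤ 1 := fun n => (abs_pow_lt_one hq n).le
  have s0 := (hh.summable_mul hq1 hq2 hρ hk).hasSum
  have s1 := (hh.summable_mul hq1 hq2 hρ (hk.succ hq)).hasSum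
  have s2 := (hh.summable_mul hq1 hq2 hρ (hk.mul_le_one hqn)).hasSum
  have t1 := hasSum_qNum_mul (f := fun n => h (n - 1) * k n) hq1 hq2 s1
  have t2 := hasSum_qNum_mul (f := fun n => h (n - 1) * k (n - 1)) hq1 hq2 s0
  have t3 := hasSum_qNum_mul (f := fun n => h (n - 1) * (q ^ n * k (n - 1))) hq1 hq2 s2
  set S0 := ∑' n, ρ ^ n / qFact q n * (h n * k n)
  set S1 := ∑' n, ρ ^ n / qFact q n * (h n * k (n + 1))
  set S2 := ∑' n, ρ ^ n / qFact q n * (h n * (q ^ (n + 1) * k n))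
  -- the sum of `c_n [n] h_n k_(n-1)` from the recurrence of `k`
  have s3 : HasSum (fun n => ρ ^ n / qFact q n * (qNum q n * (h n * k (n - 1))))
      (y * S0 - ρ * a * S2 - S1) := by
    refine (((s0.mul_left y).sub (s2.mul_left (ρ * a))).sub s1).congr_fun fun n => ?_
    have := H_succ y (ρ * (q * a)) q n
    rw [← k_def] at this
    rw [this]; ring
  have e : HasSum (fun n => ρ ^ n / qFact q n * (H x a q n * H y (ρ * a) q n))
      (S0 - (1 - q) * a * (ρ * S1) - (1 - q) * (ρ * a) * (y * S0 - ρ * a * S2 - S1) +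
        (1 - q) * a * (ρ * a) * (ρ * S0 - ρ * S2)) := by
    refine (((s0.sub (t1.mul_left ((1 - q) * a))).sub (s3.mul_left ((1 - q) * (ρ * a)))).add
      ((t2.sub t3).mul_left ((1 - q) * a * (ρ * a)))).congr_fun fun n => ?_
    rw [H_eq_H_mul x a q n, H_eq_H_mul y (ρ * a) q n, ← one_sub_mul_qNum,
      show q * (ρ * a) = ρ * (q * a) by ring, ← h_def, ← k_def]
    have := one_sub_mul_qNum q n
    linear_combination (ρ ^ n / qFact q n * (1 - q) * qNum q n * a * (ρ * a) *
      (h (n - 1) * k (n - 1))) * this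
  rw [kernel, e.tsum_eq, kernel, ← h_def, ← k_def, V]
  change _ = _ * S0
  ring

/-- Let S_ij be the sum with h_(n+i) k_(n+j). The recurrences and index shifts give linear relations
that determine S_10 and S_11 from S_00. Since q^n = 1 - (1 - q)[n]_q, the kernel at qρ is S_00 - (1
- q)ρ S_11; elimination produces W_0. -/
theorem kernel_zero_mul_W {x y q ρ : ℝ} (hq : |q| < 1) (hρ : |ρ| < 1)
    (hx : (1 - q) * x ^ 2 ≤ 4) (hy : (1 - q) * y ^ 2 ≤ 4) :
    kernel x y q ρ 0 * W 0 x y ρ q =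
      (1 - ρ ^ 2) * (1 - q * ρ ^ 2) * kernel x y q (q * ρ) 0 := by
  have hq1 := (abs_lt.1 hq).1
  have hq2 := (abs_lt.1 hq).2.le
  have hh := subexpGrowth_H hq hx 0
  have hk := subexpGrowth_H hq hy 0
  have rh := fun n => H_succ x 0 q n
  have rk := fun n => H_succ y 0 q n
  simp only [kernel, mul_zero]
  simp only [zero_mul, sub_zero] at rh rk
  set h := H x 0 q with h_def
  set k := H y 0 q with k_def
  have s00 := (hh.summable_mul hq1 hq2 hρ hk).hasSum
  have s01 := (hh.summable_mul hq1 hq2 hρ (hk.succ hq)).hasSum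
  have s10 := ((hh.succ hq).summable_mul hq1 hq2 hρ hk).hasSum
  have s11 := ((hh.succ hq).summable_mul hq1 hq2 hρ (hk.succ hq)).hasSum
  have s20 := (((hh.succ hq).succ hq).summable_mul hq1 hq2 hρ hk).hasSum
  have sq := (hh.summable_mul hq1 hq2 hρ
    (hk.mul_le_one (e := fun n => q ^ n) fun n => by
      rw [abs_pow]; exact pow_le_one₀ (abs_nonneg _) hq.le)).hasSum
  have t01 := hasSum_qNum_mul (f := fun n => h (n - 1) * k n) hq1 hq2 s01
  have t10 := hasSum_qNum_mul (f := fun n => h n * k (n - 1)) hq1 hq2 s10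
  have t11 := hasSum_qNum_mul (f := fun n => h n * k n) hq1 hq2 s11
  have t20 := hasSum_qNum_mul (f := fun n => h (n + 1) * k (n - 1)) hq1 hq2 s20
  have esq : ∑' n, (q * ρ) ^ n / qFact q n * (h n * k n) =
      ∑' n, ρ ^ n / qFact q n * (h n * (q ^ n * k n)) :=
    tsum_congr fun n => by rw [mul_pow]; ring
  rw [esq]
  set S00 := ∑' n, ρ ^ n / qFact q n * (h n * k n)
  set S01 := ∑' n, ρ ^ n / qFact q n * (h n * k (n + 1))
  set S10 := ∑' n, ρ ^ n / qFact q n * (h (n + 1) * k n)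
  set S11 := ∑' n, ρ ^ n / qFact q n * (h (n + 1) * k (n + 1))
  set S20 := ∑' n, ρ ^ n / qFact q n * (h (n + 1 + 1) * k n)
  set Sq := ∑' n, ρ ^ n / qFact q n * (h n * (q ^ n * k n))
  have e1 : S10 = x * S00 - ρ * S01 := s10.unique <|
    ((s00.mul_left x).sub t01).congr_fun fun n => by rw [rh]; ring
  have e2 : S01 = y * S00 - ρ * S10 := s01.unique <|
    ((s00.mul_left y).sub t10).congr_fun fun n => by rw [rk]; ring
  have e3 : S11 = y * S10 - ρ * S20 := s11.unique <|
    ((s10.mul_left y).sub t20).congr_fun fun n => by rw [rk]; ring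
  have e4 : S20 = x * S10 - S00 - q * (ρ * S11) := s20.unique <|
    (((s10.mul_left x).sub s00).sub (t11.mul_left q)).congr_fun fun n => by
      rw [rh (n + 1), qNum_succ', Nat.add_sub_cancel]; ring
  have e5 : Sq = S00 - (1 - q) * (ρ * S11) := sq.unique <|
    (s00.sub (t11.mul_left (1 - q))).congr_fun fun n => by
      have := one_sub_mul_qNum q n
      linear_combination (ρ ^ n / qFact q n * (h n * k n)) * this
  have e6 : (1 - ρ ^ 2) * S10 = (x - ρ * y) * S00 := by
    linear_combination e1 - ρ * e2
  have e7 : (1 - q * ρ ^ 2) * S11 = (y - ρ * x) * S10 + ρ * S00 := by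
    linear_combination e3 - ρ * e4
  rw [e5, W]
  linear_combination ((1 - q) * ρ * (1 - ρ ^ 2)) * e7 + (1 - q) * ρ * (y - ρ * x) * e6

/-- The growth constants are uniform for parameters bounded by |a|, so a single geometric series
dominates. Used for the limits q^m a → 0 and q^m ρ → 0. -/
theorem tendsto_kernel {x y q ρ a : ℝ} (hq : |q| < 1) (hρ : |ρ| < 1)
    (hx : (1 - q) * x ^ 2 ≤ 4) (hy : (1 - q) * y ^ 2 ≤ 4) {s b : ℕ → ℝ} {s' b' : ℝ}
    (hs : ∀ m, |s m| ≤ |ρ|) (hb : ∀ m, |b m| ≤ |a|)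
    (hs' : Tendsto s atTop (𝓝 s')) (hb' : Tendsto b atTop (𝓝 b')) :
    Tendsto (fun m => kernel x y q (s m) (b m)) atTop (𝓝 (kernel x y q s' b')) := by
  obtain ⟨r, hr, hr1⟩ := exists_one_lt_mul_lt_one hρ
  obtain ⟨K, hK⟩ := exists_H_sq_le hq hx |a| hr
  obtain ⟨L, hL⟩ := exists_H_sq_le hq hy |a| hr
  have hq' := abs_lt.1 hq
  have hKL : 0 ≤ K + L := by
    have h1 := hK 0 (by simp) 0
    have h2 := hL 0 (by simp) 0
    simp [H, qFact] at h1 h2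
    linarith
  refine tendsto_tsum_of_dominated_convergence
    ((summable_geometric_of_lt_one (by positivity) hr1).mul_left (K + L)) (fun n => ?_)
    (Eventually.of_forall fun m n => ?_)
  · have c1 := ((continuous_H x n).tendsto (b', q)).comp (hb'.prodMk_nhds tendsto_const_nhds)
    have c2 := ((continuous_H y n).tendsto (s' * b', q)).comp
      ((hs'.mul hb').prodMk_nhds tendsto_const_nhds)
    exact ((hs'.pow n).div_const _).mul (c1.mul c2)
  · have hsb : |s m * b m| ≤ |a| := by
      rw [abs_mul]
      exact (mul_le_of_le_one_left (abs_nonneg _) ((hs m).trans hρ.le)).trans (hb m)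
    refine (abs_qWeight_mul_le hq'.1 hq'.2.le (hK _ (hb m) n) (hL _ hsb n)).trans ?_
    have := hs m
    gcongr

theorem kernel_zero_zero (x y q : ℝ) : kernel x y q 0 0 = 1 := by
  rw [kernel, tsum_eq_single 0 fun n hn => by simp [hn]]
  simp [H, qFact]

/-! ### Positivity of the factors and convergence of the infinite products. -/

theorem mem_S_iff {q x : ℝ} (hq : q < 1) : x ∈ S q ↔ (1 - q) * x ^ 2 ≤ 4 := by
  have h1 : 0 < 1 - q := by linarith
  have h2 := Real.sqrt_pos.2 h1
  rw [S, if_neg hq.ne, Set.mem_Icc, ← abs_le, le_div_iff₀ h2,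
    ← sq_le_sq₀ (by positivity) zero_le_two, mul_pow, sq_abs, Real.sq_sqrt h1.le]
  constructor <;> intro h <;> linarith

/-- With ξ = 2 cos θ and η = 2 cos φ, the right side factors as the product of 1 - 2s cos(θ ± φ) +
s², each factor being at least (1 - |s|)². -/
theorem one_sub_abs_pow_four_le {ξ η s : ℝ} (hξ : ξ ^ 2 ≤ 4) (hη : η ^ 2 ≤ 4) :
    (1 - |s|) ^ 4 ≤ (1 - s ^ 2) ^ 2 - ξ * η * s * (1 + s ^ 2) + s ^ 2 * (ξ ^ 2 + η ^ 2) := by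
  have aux : ∀ t : ℝ, t ^ 2 ≤ 4 → ∃ θ, t = 2 * Real.cos θ := fun t ht => by
    have := abs_le.1 (abs_le_of_sq_le_sq (b := 2) (a := t) (by linarith) (by norm_num))
    exact ⟨Real.arccos (t / 2), by
      rw [Real.cos_arccos (by linarith [this.1]) (by linarith [this.2])]; ring⟩
  obtain ⟨θ, rfl⟩ := aux ξ hξ
  obtain ⟨φ, rfl⟩ := aux η hη
  have hc : ∀ α : ℝ, (1 - |s|) ^ 2 ≤ 1 - 2 * s * Real.cos α + s ^ 2 := fun α => by
    have h1 : s * Real.cos α ≤ |s| := by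
      refine (le_abs_self _).trans ?_
      rw [abs_mul]
      exact mul_le_of_le_one_right (abs_nonneg _) (Real.abs_cos_le_one α)
    nlinarith [sq_abs s]
  calc (1 - |s|) ^ 4 = (1 - |s|) ^ 2 * (1 - |s|) ^ 2 := by ring
    _ ≤ (1 - 2 * s * Real.cos (θ + φ) + s ^ 2) * (1 - 2 * s * Real.cos (θ - φ) + s ^ 2) :=
      mul_le_mul (hc _) (hc _) (sq_nonneg _) ((sq_nonneg _).trans (hc _))
    _ = _ := by
      rw [Real.cos_add, Real.cos_sub]
      linear_combination (-4 * s ^ 2 * Real.sin φ ^ 2) * Real.sin_sq_add_cos_sq θ +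
        (4 * s ^ 2 * (Real.cos θ ^ 2 - 1)) * Real.sin_sq_add_cos_sq φ

theorem W_eq_W_zero (k : ℕ) (x y t q : ℝ) : W k x y t q = W 0 x y (q ^ k * t) q := by
  simp only [W]; ring

theorem V_eq_V_zero (k : ℕ) (y a q : ℝ) : V k y a q = V 0 y (q ^ k * a) q := by
  simp only [V]; ring

theorem le_W {q x y t : ℝ} (hq : |q| < 1) (ht : |t| < 1) (hx : (1 - q) * x ^ 2 ≤ 4)
    (hy : (1 - q) * y ^ 2 ≤ 4) (k : ℕ) : (1 - |t|) ^ 4 ≤ W k x y t q := by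
  have hq2 := (abs_lt.1 hq).2
  have hs2 : √(1 - q) ^ 2 = 1 - q := Real.sq_sqrt (by linarith)
  have hkt : |q ^ k * t| ≤ |t| := by
    rw [abs_mul, abs_pow]
    exact mul_le_of_le_one_left (abs_nonneg _) (pow_le_one₀ (abs_nonneg _) hq.le)
  have h := one_sub_abs_pow_four_le (ξ := √(1 - q) * x) (η := √(1 - q) * y) (s := q ^ k * t)
    (by rw [mul_pow, hs2]; exact hx) (by rw [mul_pow, hs2]; exact hy)
  calc (1 - |t|) ^ 4 ≤ (1 - |q ^ k * t|) ^ 4 := by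
        have : 0 ≤ 1 - |t| := by linarith
        gcongr
    _ ≤ _ := h
    _ = W k x y t q := by
      rw [W]
      linear_combination (-x * y * (q ^ k * t) * (1 + (q ^ k * t) ^ 2) +
        (q ^ k * t) ^ 2 * (x ^ 2 + y ^ 2)) * hs2

theorem W_pos {q x y t : ℝ} (hq : |q| < 1) (ht : |t| < 1) (hx : (1 - q) * x ^ 2 ≤ 4)
    (hy : (1 - q) * y ^ 2 ≤ 4) (k : ℕ) : 0 < W k x y t q :=
  (pow_pos (sub_pos.2 ht) 4).trans_le (le_W hq ht hx hy k)

theorem V_nonneg {q y : ℝ} (hq : |q| < 1) (hy : (1 - q) * y ^ 2 ≤ 4) (b : ℝ) (k : ℕ) :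
    0 ≤ V k y b q := by
  have h1 : 0 < 1 - q := by linarith [(abs_lt.1 hq).2]
  have h2 : V k y b q = (1 - (1 - q) * (b * q ^ k) * y / 2) ^ 2 +
      (1 - q) * (b * q ^ k) ^ 2 * (4 - (1 - q) * y ^ 2) / 4 := by
    rw [V]; ring
  rw [h2]
  have : 0 ≤ 4 - (1 - q) * y ^ 2 := by linarith
  positivity

theorem multipliable_qPoch {q : ℝ} (hq : |q| < 1) (c : ℝ) :
    Multipliable fun k : ℕ => 1 - c * q ^ k := by
  have := Real.multipliable_one_add_of_summable
    ((summable_geometric_of_abs_lt_one hq).mul_left (-c))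
  simpa only [neg_mul, ← sub_eq_add_neg] using this

theorem multipliable_V {q : ℝ} (hq : |q| < 1) (y b : ℝ) :
    Multipliable fun k : ℕ => V k y b q := by
  have hq2 : |q ^ 2| < 1 := abs_pow_lt_one hq 1
  have := Real.multipliable_one_add_of_summable
    (((summable_geometric_of_abs_lt_one hq).mul_left (-((1 - q) * b * y))).add
      ((summable_geometric_of_abs_lt_one hq2).mul_left ((1 - q) * b ^ 2)))
  refine this.congr fun k => ?_
  rw [V, ← pow_mul]; ring

/-- Write 1/W = 1 + (1 - W)/W: the numerator is O(|q|^k), and W is bounded below uniformly in k by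
`le_W`. -/
theorem multipliable_W_inv {q x y t : ℝ} (hq : |q| < 1) (ht : |t| < 1)
    (hx : (1 - q) * x ^ 2 ≤ 4) (hy : (1 - q) * y ^ 2 ≤ 4) :
    Multipliable fun k : ℕ => (W k x y t q)⁻¹ := by
  have hpos := W_pos hq ht hx hy
  have hq2 := (abs_lt.1 hq).2
  have hd : 0 < (1 - |t|) ^ 4 := pow_pos (sub_pos.2 ht) 4
  set C := 3 + (1 - q) * |x * y| * 2 + (1 - q) * (x ^ 2 + y ^ 2) with hC
  have hC0 : 0 ≤ C := by
    have : 0 ≤ 1 - q := by linarith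
    positivity
  have hsum : Summable fun k => (1 - W k x y t q) / W k x y t q := by
    refine Summable.of_norm_bounded
      ((summable_geometric_of_lt_one (abs_nonneg q) hq).mul_left (C / (1 - |t|) ^ 4)) fun k => ?_
    have h1 : |q ^ k * t| ≤ |q| ^ k := by
      rw [abs_mul, abs_pow]; exact mul_le_of_le_one_right (by positivity) ht.le
    have h2 : |q| ^ k ≤ 1 := pow_le_one₀ (abs_nonneg _) hq.le
    have h3 : |1 - W k x y t q| ≤ C * |q| ^ k := by
      set s := q ^ k * t
      have hs := h1.trans h2
      have e : 1 - W k x y t q = s * (2 * s - s * s ^ 2 + (1 - q) * (x * y) * (1 + s ^ 2) -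
          (1 - q) * s * (x ^ 2 + y ^ 2)) := by rw [W]; ring
      have hs2 : s ^ 2 ≤ 1 := (sq_le_one_iff_abs_le_one _).2 hs
      have hq0 : 0 ≤ 1 - q := by linarith
      rw [e, abs_mul, mul_comm C]
      refine mul_le_mul h1 ?_ (abs_nonneg _) (by positivity)
      calc |2 * s - s * s ^ 2 + (1 - q) * (x * y) * (1 + s ^ 2) - (1 - q) * s * (x ^ 2 + y ^ 2)|
          ≤ |2 * s| + |s * s ^ 2| + |(1 - q) * (x * y) * (1 + s ^ 2)| +
            |(1 - q) * s * (x ^ 2 + y ^ 2)| :=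
            (abs_sub _ _).trans (add_le_add_left ((abs_add_le _ _).trans
              (add_le_add_left (abs_sub _ _) _)) _)
        _ = 2 * |s| + |s| * s ^ 2 + (1 - q) * |x * y| * (1 + s ^ 2) +
            (1 - q) * |s| * (x ^ 2 + y ^ 2) := by
            simp only [abs_mul, abs_of_nonneg hq0, abs_of_nonneg (sq_nonneg s), abs_two,
              abs_of_nonneg (show 0 ≤ 1 + s ^ 2 by positivity),
              abs_of_nonneg (show 0 ≤ x ^ 2 + y ^ 2 by positivity)]
        _ ≤ 2 * 1 + 1 * 1 + (1 - q) * |x * y| * (1 + 1) + (1 - q) * 1 * (x ^ 2 + y ^ 2) := by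
            gcongr
        _ = C := by rw [hC]; ring
    rw [Real.norm_eq_abs, abs_div, abs_of_pos (hpos k)]
    calc |1 - W k x y t q| / W k x y t q ≤ (C * |q| ^ k) / (1 - |t|) ^ 4 := by
          gcongr
          exact le_W hq ht hx hy k
      _ = _ := by ring
  refine (Real.multipliable_one_add_of_summable hsum).congr fun k => ?_
  have := (hpos k).ne'
  field_simp
  ring

/-! ### The product formula and nonnegativity for |q| < 1. -/

theorem kernel_eq_prod_V_mul {x y q ρ : ℝ} (hq : |q| < 1) (hρ : |ρ| < 1)
    (hx : (1 - q) * x ^ 2 ≤ 4) (hy : (1 - q) * y ^ 2 ≤ 4) (a : ℝ) (m : ℕ) :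
    kernel x y q ρ a = (∏ k ∈ range m, V k y (ρ * a) q) * kernel x y q ρ (q ^ m * a) := by
  induction m with
  | zero => simp
  | succ m ih =>
    rw [ih, kernel_eq_V_mul_kernel hq hρ hx hy (q ^ m * a), Finset.prod_range_succ,
      V_eq_V_zero m, ← mul_assoc, mul_left_comm ρ, ← mul_assoc q, ← pow_succ']

/-- Replacing ρ by q^m ρ in the functional equation gives the Pochhammer factors of index 2m and 2m
+ 1, hence `range (2 * m)` against m factors W. -/
theorem kernel_zero_mul_prod_W {x y q ρ : ℝ} (hq : |q| < 1) (hρ : |ρ| < 1)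
    (hx : (1 - q) * x ^ 2 ≤ 4) (hy : (1 - q) * y ^ 2 ≤ 4) (m : ℕ) :
    kernel x y q ρ 0 * ∏ k ∈ range m, W k x y ρ q =
      (∏ k ∈ range (2 * m), (1 - ρ ^ 2 * q ^ k)) * kernel x y q (q ^ m * ρ) 0 := by
  induction m with
  | zero => simp
  | succ m ih =>
    have hm : |q ^ m * ρ| < 1 := by
      rw [abs_mul, abs_pow]
      exact (mul_le_of_le_one_left (abs_nonneg _) (pow_le_one₀ (abs_nonneg _) hq.le)).trans_lt hρ
    have h := kernel_zero_mul_W hq hm hx hy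
    rw [← W_eq_W_zero, ← mul_assoc q, ← pow_succ'] at h
    rw [Finset.prod_range_succ, ← mul_assoc, ih, mul_assoc, h, mul_add_one,
      Finset.prod_range_succ, Finset.prod_range_succ]
    ring

theorem kernel_zero_eq {x y q ρ : ℝ} (hq : |q| < 1) (hρ : |ρ| < 1)
    (hx : (1 - q) * x ^ 2 ≤ 4) (hy : (1 - q) * y ^ 2 ≤ 4) :
    kernel x y q ρ 0 = qPochInf (ρ ^ 2) q * ∏' k, (W k x y ρ q)⁻¹ := by
  have hpow := tendsto_pow_atTop_nhds_zero_of_abs_lt_one hq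
  have h1 : Tendsto (fun m => kernel x y q (q ^ m * ρ) 0) atTop (𝓝 1) := by
    rw [← kernel_zero_zero x y q]
    refine tendsto_kernel (a := 0) hq hρ hx hy (fun m => ?_) (fun _ => le_rfl) ?_
      tendsto_const_nhds
    · rw [abs_mul, abs_pow]
      exact mul_le_of_le_one_left (abs_nonneg _) (pow_le_one₀ (abs_nonneg _) hq.le)
    · simpa using hpow.mul_const ρ
  have h2 := (multipliable_W_inv hq hρ hx hy).tendsto_prod_tprod_nat
  have h3 := (multipliable_qPoch hq (ρ ^ 2)).tendsto_prod_tprod_nat.comp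
    (tendsto_id.const_mul_atTop' (zero_lt_two' ℕ))
  refine tendsto_nhds_unique (l := atTop) (f := fun _ : ℕ => kernel x y q ρ 0)
    tendsto_const_nhds ?_
  have h4 := (h3.mul h1).mul h2
  rw [mul_one] at h4
  refine h4.congr fun m => ?_
  have h5 := kernel_zero_mul_prod_W hq hρ hx hy m
  have h6 : ∏ k ∈ range m, W k x y ρ q ≠ 0 :=
    Finset.prod_ne_zero_iff.2 fun k _ => (W_pos hq hρ hx hy k).ne'
  simp only [Function.comp_apply, id]
  rw [← h5, Finset.prod_inv_distrib, mul_inv_cancel_right₀ h6]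

theorem multipliable_V_div_W {x y q ρ : ℝ} (hq : |q| < 1) (hρ : |ρ| < 1)
    (hx : (1 - q) * x ^ 2 ≤ 4) (hy : (1 - q) * y ^ 2 ≤ 4) (b : ℝ) :
    Multipliable fun k : ℕ => V k y b q / W k x y ρ q := by
  simp only [div_eq_mul_inv]
  exact (multipliable_V hq y b).mul (multipliable_W_inv hq hρ hx hy)

theorem kernel_eq {x y q ρ : ℝ} (hq : |q| < 1) (hρ : |ρ| < 1)
    (hx : (1 - q) * x ^ 2 ≤ 4) (hy : (1 - q) * y ^ 2 ≤ 4) (a : ℝ) :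
    kernel x y q ρ a = qPochInf (ρ ^ 2) q * ∏' k, V k y (ρ * a) q / W k x y ρ q := by
  have hpow := tendsto_pow_atTop_nhds_zero_of_abs_lt_one hq
  have h1 : Tendsto (fun m => kernel x y q ρ (q ^ m * a)) atTop (𝓝 (kernel x y q ρ 0)) := by
    refine tendsto_kernel (a := a) hq hρ hx hy (fun _ => le_rfl) (fun m => ?_)
      tendsto_const_nhds ?_
    · rw [abs_mul, abs_pow]
      exact mul_le_of_le_one_left (abs_nonneg _) (pow_le_one₀ (abs_nonneg _) hq.le)
    · simpa using hpow.mul_const a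
  have hV := multipliable_V hq y (ρ * a)
  have h2 : kernel x y q ρ a = (∏' k, V k y (ρ * a) q) * kernel x y q ρ 0 := by
    refine tendsto_nhds_unique (l := atTop) (f := fun _ : ℕ => kernel x y q ρ a)
      tendsto_const_nhds ?_
    refine (hV.tendsto_prod_tprod_nat.mul h1).congr fun m => ?_
    exact (kernel_eq_prod_V_mul hq hρ hx hy a m).symm
  simp only [div_eq_mul_inv]
  rw [h2, hV.tprod_mul (multipliable_W_inv hq hρ hx hy), kernel_zero_eq hq hρ hx hy]
  ring

theorem kernel_nonneg {x y q ρ : ℝ} (hq : |q| < 1) (hρ : |ρ| < 1)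
    (hx : (1 - q) * x ^ 2 ≤ 4) (hy : (1 - q) * y ^ 2 ≤ 4) (a : ℝ) : 0 ≤ kernel x y q ρ a := by
  rw [kernel_eq hq hρ hx hy]
  refine mul_nonneg ?_ ?_
  · refine ge_of_tendsto' (multipliable_qPoch hq (ρ ^ 2)).hasProd fun s =>
      Finset.prod_nonneg fun k _ => ?_
    have h1 : ρ ^ 2 ≤ 1 := (sq_le_one_iff_abs_le_one _).2 hρ.le
    have h2 : q ^ k ≤ 1 := (le_abs_self _).trans (by
      rw [abs_pow]; exact pow_le_one₀ (abs_nonneg _) hq.le)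
    nlinarith [sq_nonneg ρ]
  · exact ge_of_tendsto' (multipliable_V_div_W hq hρ hx hy _).hasProd fun s =>
      Finset.prod_nonneg fun k _ => div_nonneg (V_nonneg hq hy _ k) (W_pos hq hρ hx hy k).le

/-! ### The case q = 1 as a limit. -/

theorem summable_kernel_one {ρ : ℝ} (hρ : |ρ| < 1) (x y a : ℝ) :
    Summable fun n => ρ ^ n / qFact 1 n * (H x a 1 n * H y (ρ * a) 1 n) := by
  have h : ∀ z c : ℝ, SubexpGrowth 1 (H z c 1) := fun z c r hr => by
    obtain ⟨K, hK⟩ := exists_eventually_H_sq_le (|z| + |c|) hr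
    -- The uniform bound was stated on 𝓝[≤] 1, which includes the point q = 1 itself.
    exact ⟨K, (hK.self_of_nhdsWithin Set.self_mem_Iic).2 z c le_rfl⟩
  exact (h x a).summable_mul (by norm_num) le_rfl hρ (h y (ρ * a))

theorem tendsto_kernel_one {ρ : ℝ} (hρ : |ρ| < 1) (x y a : ℝ) :
    Tendsto (fun q => kernel x y q ρ a) (𝓝[<] 1) (𝓝 (kernel x y 1 ρ a)) := by
  obtain ⟨r, hr, hr1⟩ := exists_one_lt_mul_lt_one hρ
  obtain ⟨K, hK⟩ := exists_eventually_H_sq_le (|x| + |a|) hr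
  obtain ⟨L, hL⟩ := exists_eventually_H_sq_le (|y| + |ρ * a|) hr
  refine tendsto_tsum_of_dominated_convergence
    ((summable_geometric_of_lt_one (by positivity) hr1).mul_left (K + L)) (fun n => ?_) ?_
  · have c0 : Continuous fun q : ℝ => H x a q n :=
      (continuous_H x n).comp (continuous_const.prodMk continuous_id)
    have c1 : Continuous fun q : ℝ => H y (ρ * a) q n :=
      (continuous_H y n).comp (continuous_const.prodMk continuous_id)
    have h : ContinuousAt (fun q => ρ ^ n / qFact q n * (H x a q n * H y (ρ * a) q n)) 1 :=
      (continuousAt_const.div (continuous_qFact n).continuousAt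
        (qFact_pos (by norm_num) le_rfl n).ne').mul (c0.mul c1).continuousAt
    exact h.tendsto.mono_left nhdsWithin_le_nhds
  · have hle : 𝓝[<] (1 : ℝ) ≤ 𝓝[≤] 1 := nhdsWithin_mono _ Set.Iio_subset_Iic_self
    filter_upwards [hK.filter_mono hle, hL.filter_mono hle, self_mem_nhdsWithin] with q h1 h2 h3 n
    exact abs_qWeight_mul_le (by linarith [h1.1]) (le_of_lt h3)
      (h1.2 x a le_rfl n) (h2.2 y (ρ * a) le_rfl n)

theorem kernel_one_nonneg {ρ : ℝ} (hρ : |ρ| < 1) (x y a : ℝ) : 0 ≤ kernel x y 1 ρ a := by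
  refine ge_of_tendsto (tendsto_kernel_one hρ x y a) ?_
  -- The intervals S(q) exhaust the line as q → 1, so any fixed real point eventually lies in S(q).
  have h : ∀ z : ℝ, ∀ᶠ q in 𝓝[<] (1 : ℝ), (1 - q) * z ^ 2 ≤ 4 := fun z => by
    have hc : Continuous fun q : ℝ => (1 - q) * z ^ 2 := by fun_prop
    have := (hc.tendsto 1).mono_left (nhdsWithin_le_nhds (s := Set.Iio 1))
    exact this.eventually_le_const (by norm_num)
  filter_upwards [h x, h y, self_mem_nhdsWithin,
    mem_nhdsWithin_of_mem_nhds (eventually_ge_nhds (zero_lt_one' ℝ))] with q hx hy hq1 hq0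
  exact kernel_nonneg (by rw [abs_of_nonneg hq0]; exact hq1) hρ hx hy a

end BigQHermite

theorem mainTheorem2 (q a b x y : ℝ) (hq : -1 < q) (hq1 : q ≤ 1) (hab : |b| < |a|)
    (hx : x ∈ BigQHermite.S q) (hy : y ∈ BigQHermite.S q) :
    Summable (fun n : ℕ =>
        b ^ n / (BigQHermite.qFact q n * a ^ n) *
          (BigQHermite.H x a q n * BigQHermite.H y b q n)) ∧
    0 ≤ ∑' n : ℕ, b ^ n / (BigQHermite.qFact q n * a ^ n) *
          (BigQHermite.H x a q n * BigQHermite.H y b q n) ∧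
    (q < 1 →
      Multipliable (fun k : ℕ => 1 - b ^ 2 / a ^ 2 * q ^ k) ∧
      (∀ k : ℕ, BigQHermite.W k x y (b / a) q ≠ 0) ∧
      Multipliable (fun k : ℕ =>
        BigQHermite.V k y b q / BigQHermite.W k x y (b / a) q) ∧
      ∑' n : ℕ, b ^ n / (BigQHermite.qFact q n * a ^ n) *
          (BigQHermite.H x a q n * BigQHermite.H y b q n) =
        BigQHermite.qPochInf (b ^ 2 / a ^ 2) q *
          ∏' k : ℕ, BigQHermite.V k y b q / BigQHermite.W k x y (b / a) q) := by
  have ha : a ≠ 0 := fun h => by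
    rw [h, abs_zero] at hab; exact absurd hab (not_lt.2 (abs_nonneg b))
  obtain ⟨ρ, rfl⟩ : ∃ ρ, b = ρ * a := ⟨b / a, (div_mul_cancel₀ b ha).symm⟩
  have hρ : |ρ| < 1 := by
    rw [abs_mul] at hab
    exact (mul_lt_iff_lt_one_left (abs_pos.2 ha)).1 hab
  have e1 : ∀ n, (ρ * a) ^ n / (BigQHermite.qFact q n * a ^ n) = ρ ^ n / BigQHermite.qFact q n :=
    fun n => by rw [mul_pow, mul_div_mul_right _ _ (pow_ne_zero n ha)]
  have e2 : (ρ * a) ^ 2 / a ^ 2 = ρ ^ 2 := by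
    rw [mul_pow, mul_div_cancel_right₀ _ (pow_ne_zero 2 ha)]
  simp only [e1, e2, mul_div_cancel_right₀ ρ ha]
  rcases hq1.lt_or_eq with h | rfl
  · have hq' : |q| < 1 := abs_lt.2 ⟨hq, h⟩
    rw [BigQHermite.mem_S_iff h] at hx hy
    exact ⟨BigQHermite.summable_kernel hq' hρ hx hy a, BigQHermite.kernel_nonneg hq' hρ hx hy a,
      fun _ => ⟨BigQHermite.multipliable_qPoch hq' _,
        fun k => (BigQHermite.W_pos hq' hρ hx hy k).ne',
        BigQHermite.multipliable_V_div_W hq' hρ hx hy _, BigQHermite.kernel_eq hq' hρ hx hy a⟩⟩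
  · exact ⟨BigQHermite.summable_kernel_one hρ x y a, BigQHermite.kernel_one_nonneg hρ x y a,
      fun h => absurd h (lt_irrefl _)⟩
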